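/- Let $d\ge 1$, $\alpha\in(-1,\infty)^d$, $\mathbb{R}_+^d=(0,\infty)^d$. For $\nu>-1$, $z>0$ let $I_\nu(z)=\sum_{m\ge 0}\frac{(z/2)^{2m+\nu}}{m!\,\Gamma(m+\nu+1)}$ be the modified Bessel function of the first kind, and for $t>0$ and $x,y\in\mathbb{R}_+^d$ let $$p_t^\alpha(x,y)=\frac{1}{2\sqrt{\pi}}\int_0^1\frac{t\,e^{\frac{t^2}{4\log r}}}{(1-r)^d(-\log r)^{3/2}}\prod_{j=1}^d\Big(\frac{y_j}{x_j}\Big)^{\frac{\alpha_j}{2}}e^{-\frac{rx_j+y_j}{1-r}-\frac{\alpha_j\log r}{2}}\,I_{\alpha_j}\Big(\frac{2\sqrt{rx_jy_j}}{1-r}\Big)\frac{dr}{r}$$ be the Poisson–Laguerre kernel. Put $\rho_j=\rho_j(t,x,y)=\frac{\sqrt{e^{-t}x_jy_j}}{1-e^{-t}}$. Then for all $x,y\in\mathbb{R}_+^d$ the function $t\mapsto p_t^\alpha(x,y)$ is infinitely differentiable on $(0,\infty)$, and the following hold, where in each item $C>0$ is a constant independent of $t>0$ and $x\in\mathbb{R}_+^d$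 and the integrand is integrable on the stated domain. * One has $\int_{\mathbb{R}_+^d}\big|\partial_t p_t^\alpha(x,y)\big|\,dy\le \frac{C}{t}$ for all $t>0$, $x\in\mathbb{R}_+^d$. In particular, the following hold. * (i) $\int_{\{y\in\mathbb{R}_+^d:\ \rho_j\le 1\ \text{for all } j\}}\big|\partial_t p_t^\alpha(x,y)\big|\,dy\le \frac{C}{t}$. * (ii) If $\alpha\in(-\frac12,\infty)^d$, then $\int_{\{y\in\mathbb{R}_+^d:\ \rho_j>1\ \text{for all } j\}}\big|\partial_t p_t^\alpha(x,y)\big|\,dy\le \frac{C}{t}$. * (iii) If $J\subseteq\{1,\dots,d\}$ and $\alpha_j>-\frac12$ for every $j\notin J$, then $\int_{\{y\in\mathbb{R}_+^d:\ \rho_j\le 1\ (j\in J),\ \rho_j>1\ (j\notin J)\}}\big|\partial_t p_t^\alpha(x,y)\big|\,dy\le \frac{C}{t}$. * If $\alpha\in(-\frac12,\infty)^d$, then for every integer $k\ge 1$, $\int_{\mathbb{R}_+^d}\big|\partial_t^k p_t^\alpha(x,y)\big|\,dy\le\frac{C}{t^k}$ for all $t>0$, $x\in\mathbb{R}_+^d$.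 -/

import Mathlib

open Set MeasureTheory

/-- The space `ℝ₊^d = (0, ∞)^d`. -/
def posOrthant (d : ℕ) : Set (Fin d → ℝ) := {y | ∀ j, 0 < y j}

/-- The modified Bessel function of the first kind `I_ν(z)`, for real order `ν` and `z > 0`:
`I_ν(z) = ∑_{m ≥ 0} (z/2)^{2m+ν} / (m! Γ(m+ν+1))`. -/
noncomputable def besselI (ν z : ℝ) : ℝ :=
  ∑' m : ℕ, (z / 2) ^ (2 * (m : ℝ) + ν) / ((m.factorial : ℝ) * Real.Gamma ((m : ℝ) + ν + 1))

/-- The Poisson–Laguerre kernel `p_t^α(x, y)` (with respect to Lebesgue measure `dy`). -/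
noncomputable def poissonLaguerreKernel {d : ℕ} (α : Fin d → ℝ) (t : ℝ) (x y : Fin d → ℝ) : ℝ :=
  1 / (2 * √Real.pi) *
    ∫ r in Ioo (0 : ℝ) 1,
      t * Real.exp (t ^ 2 / (4 * Real.log r)) / ((1 - r) ^ d * (-Real.log r) ^ (3 / 2 : ℝ)) *
        (∏ j, (y j / x j) ^ (α j / 2) *
          Real.exp (-((r * x j + y j) / (1 - r)) - α j * Real.log r / 2) *
          besselI (α j) (2 * √(r * x j * y j) / (1 - r))) / r

/-- The quantity `√(e^{-t} x_j y_j) / (1 - e^{-t})` that separates the regimes. -/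
noncomputable def regimeArg {d : ℕ} (t : ℝ) (x y : Fin d → ℝ) (j : Fin d) : ℝ :=
  √(Real.exp (-t) * x j * y j) / (1 - Real.exp (-t))

/-!
The Poisson-Laguerre kernel is subordinated to the Laguerre heat kernel, and the heat kernel is a
probability density in `y` for every `α ∈ (-1, ∞)^d`. Indeed, expanding the Bessel function shows
that in dimension one it is a mixture, with Poisson weights of mean `r x / (1 - r)`, of gamma
densities with shapes `m + ν + 1` and rate `1 / (1 - r)` (`hasSum_laguerreHeatFactor`), so its
integral in `y` is `1` (`integral_laguerreHeatFactor`).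

The substitution `r = e^(-1/v)` turns the kernel into
`p_t(x, y) = t / (2√π) ∫₀^∞ v^(-1/2) e^(-t² v / 4) K(v) dv`, where `K(v)` is the heat kernel at
time `1 / v` (`poissonLaguerreKernel_eq_subordination`). For fixed `x` and `y` the weight `K` grows
at most polynomially, because each gamma density is at most its rate `1 / (1 - r) ≤ 1 + v`, except
that for shapes below one a power of `y` enters. Hence one may differentiate under the integral
sign: `p_t(x, y)` is smooth in `t`, and its `k`-th derivative is a combination of the terms
`t^(2n + 1 - k) ∫₀^∞ v^(n - 1/2) e^(-t² v / 4) K(v) dv` with `n ≤ k`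
(`PolynomiallyBounded.iteratedDeriv_subordination`).

Integrating in `y` and using Tonelli's theorem, `K` disappears, and what remains of each term is
`t^(2n + 1 - k) 2^(2n + 1) Γ(n + 1/2) / t^(2n + 1)`, a multiple of `t^(-k)`. This bounds the `L¹`
norm of every time derivative over the whole orthant, for all `α ∈ (-1, ∞)^d` at once, and hence
over each of the regions cut out by the quantities `ρ_j`.
-/

section

open ProbabilityTheory

/-! ### Gamma densities -/

/-- Obtained by keeping only the part `v > b` of the integral defining `Γ(s)`, where
`v ^ (s - 1) ≥ b ^ (s - 1)`. -/
theorem rpow_mul_exp_neg_le_Gamma {s b : ℝ} (hs : 1 ≤ s) (hb : 0 < b) :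
    b ^ (s - 1) * Real.exp (-b) ≤ Real.Gamma s := by
  have hs0 : 0 < s := by linarith
  have hint := Real.GammaIntegral_convergent hs0
  have hsub : Ioi b ⊆ Ioi (0 : ℝ) := Ioi_subset_Ioi hb.le
  rw [Real.Gamma_eq_integral hs0, ← integral_exp_neg_Ioi, ← integral_const_mul]
  calc ∫ v in Ioi b, b ^ (s - 1) * Real.exp (-v)
      ≤ ∫ v in Ioi b, Real.exp (-v) * v ^ (s - 1) := by
        refine setIntegral_mono_on ?_ (hint.mono_set hsub) measurableSet_Ioi fun v hv => ?_
        · exact (integrableOn_exp_neg_Ioi b).const_mul _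
        · rw [mul_comm]
          have hv : b < v := hv
          gcongr
    _ ≤ ∫ v in Ioi 0, Real.exp (-v) * v ^ (s - 1) := by
        refine setIntegral_mono_set hint ?_ hsub.eventuallyLE
        filter_upwards [self_mem_ae_restrict measurableSet_Ioi] with v hv
        have hv : 0 < v := hv
        simp only [Pi.zero_apply]
        positivity

theorem gammaPDFReal_eq_mul {s ρ y : ℝ} (hρ : 0 < ρ) (hy : 0 < y) :
    gammaPDFReal s ρ y =
      ρ * ((ρ * y) ^ (s - 1) * Real.exp (-(ρ * y)) / Real.Gamma s) := by
  rw [gammaPDFReal, if_pos hy.le, Real.mul_rpow hρ.le hy.le, Real.rpow_sub_one hρ.ne']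
  field_simp

theorem gammaPDFReal_le {s ρ y : ℝ} (hs : 1 ≤ s) (hρ : 0 < ρ) (hy : 0 < y) :
    gammaPDFReal s ρ y ≤ ρ := by
  rw [gammaPDFReal_eq_mul hρ hy]
  have h := rpow_mul_exp_neg_le_Gamma hs (mul_pos hρ hy)
  have hΓ : 0 < Real.Gamma s := Real.Gamma_pos_of_pos (by linarith)
  exact mul_le_of_le_one_right hρ.le ((div_le_one hΓ).2 h)

/-- Unlike `gammaPDFReal_le`, this also covers shapes `m + ν + 1 < 1`, where the density is
unbounded near the origin. -/
theorem gammaPDFReal_nat_add_le {ν ρ y : ℝ} (hν : -1 < ν) (hρ : 1 ≤ ρ) (hy : 0 < y) (m : ℕ) :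
    gammaPDFReal (m + ν + 1) ρ y ≤ ρ * (1 + y ^ ν / Real.Gamma (ν + 1)) := by
  have hρ0 : 0 < ρ := by linarith
  have hΓ : 0 < Real.Gamma (ν + 1) := Real.Gamma_pos_of_pos (by linarith)
  have hy' : 0 ≤ y ^ ν / Real.Gamma (ν + 1) := by positivity
  by_cases hs : (0 : ℝ) ≤ m + ν
  · refine (gammaPDFReal_le (by linarith) hρ0 hy).trans ?_
    nlinarith
  · have hm : m = 0 := by
      by_contra h
      have : (1 : ℝ) ≤ m := by exact_mod_cast Nat.one_le_iff_ne_zero.2 h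
      linarith
    subst hm
    simp only [CharP.cast_eq_zero, zero_add] at hs ⊢
    rw [gammaPDFReal_eq_mul hρ0 hy, add_sub_cancel_right]
    gcongr
    refine le_add_of_nonneg_of_le zero_le_one ?_
    gcongr
    have h1 : (ρ * y) ^ ν ≤ y ^ ν :=
      Real.rpow_le_rpow_of_nonpos hy (le_mul_of_one_le_left hy.le hρ) (by linarith)
    have h2 : Real.exp (-(ρ * y)) ≤ 1 := Real.exp_le_one_iff.2 (by nlinarith)
    calc (ρ * y) ^ ν * Real.exp (-(ρ * y)) ≤ y ^ ν * 1 := by gcongr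
      _ = y ^ ν := mul_one _

theorem integrable_gammaPDFReal {s ρ : ℝ} (hs : 0 < s) (hρ : 0 < ρ) :
    Integrable (gammaPDFReal s ρ) := by
  refine ⟨(measurable_gammaPDFReal s ρ).aestronglyMeasurable, ?_⟩
  rw [hasFiniteIntegral_iff_ofReal (.of_forall fun y => gammaPDFReal_nonneg hs hρ y)]
  exact (lintegral_gammaPDF_eq_one hs hρ).trans_lt ENNReal.one_lt_top

theorem setIntegral_gammaPDFReal {s ρ : ℝ} (hs : 0 < s) (hρ : 0 < ρ) :
    ∫ y in Ioi 0, gammaPDFReal s ρ y = 1 := by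
  have h1 : ∫ y, gammaPDFReal s ρ y = 1 := by
    rw [integral_eq_lintegral_of_nonneg_ae (.of_forall fun y => gammaPDFReal_nonneg hs hρ y)
      (measurable_gammaPDFReal s ρ).aestronglyMeasurable]
    have := lintegral_gammaPDF_eq_one hs hρ
    unfold gammaPDF at this
    simp [this]
  rw [← h1, ← integral_Ici_eq_integral_Ioi]
  refine setIntegral_eq_integral_of_forall_compl_eq_zero fun y hy => ?_
  rw [gammaPDFReal, if_neg (by simpa using hy)]

/-! ### The one-dimensional heat kernel as a Poisson mixture of gamma densities -/

/-- The one-dimensional Laguerre heat kernel, in the time variable `r ∈ (0, 1)`, so that the heat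
semigroup time is `-log r`. -/
noncomputable def laguerreHeatFactor (ν r x y : ℝ) : ℝ :=
  (y / x) ^ (ν / 2) * Real.exp (-((r * x + y) / (1 - r)) - ν * Real.log r / 2) *
    besselI ν (2 * √(r * x * y) / (1 - r)) / (1 - r)

/-- The mass at `m` of the Poisson distribution with mean `a`. -/
noncomputable def poissonWeight (a : ℝ) (m : ℕ) : ℝ := Real.exp (-a) * (a ^ m / (m.factorial : ℝ))

theorem poissonWeight_nonneg {a : ℝ} (ha : 0 ≤ a) (m : ℕ) : 0 ≤ poissonWeight a m := by
  unfold poissonWeight; positivity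

theorem hasSum_poissonWeight (a : ℝ) : HasSum (poissonWeight a) 1 := by
  have h := (NormedSpace.expSeries_div_hasSum_exp a).mul_left (Real.exp (-a))
  rwa [← Real.exp_eq_exp_ℝ, ← Real.exp_add, neg_add_cancel, Real.exp_zero] at h

/-- Each term of the Bessel series, with its prefactors, is a Poisson mass with mean
`a = r x / (1 - r)` times a gamma density in `y` of rate `1 / (1 - r)`: with `b = y / (1 - r)`, the
powers combine as `(b / a)^(ν/2) (a b)^(m + ν/2) = a^m b^(m + ν)`. -/
theorem poissonWeight_mul_gammaPDFReal_eq {ν r x y : ℝ} (hr0 : 0 < r) (hr1 : r < 1) (hx : 0 < x)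
    (hy : 0 < y) (m : ℕ) :
    poissonWeight (r * x / (1 - r)) m * gammaPDFReal (m + ν + 1) (1 - r)⁻¹ y =
      (y / x) ^ (ν / 2) * Real.exp (-((r * x + y) / (1 - r)) - ν * Real.log r / 2) *
        ((2 * √(r * x * y) / (1 - r) / 2) ^ (2 * (m : ℝ) + ν) /
          ((m.factorial : ℝ) * Real.Gamma ((m : ℝ) + ν + 1))) / (1 - r) := by
  have h1r : 0 < 1 - r := by linarith
  have hpow : (y / x) ^ (ν / 2) * Real.exp (-(ν * Real.log r / 2)) *
      (2 * √(r * x * y) / (1 - r) / 2) ^ (2 * (m : ℝ) + ν) =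
      (r * x / (1 - r)) ^ m * ((1 - r)⁻¹ * y) ^ ((m : ℝ) + ν) := by
    have hA : 0 < r * x / (1 - r) := by positivity
    have hB : 0 < (1 - r)⁻¹ * y := by positivity
    have hsq : 2 * √(r * x * y) / (1 - r) / 2 = √((r * x / (1 - r)) * ((1 - r)⁻¹ * y)) := by
      have : (r * x / (1 - r)) * ((1 - r)⁻¹ * y) = (r * x * y) / (1 - r) ^ 2 := by
        field_simp
      rw [this, Real.sqrt_div' _ (by positivity), Real.sqrt_sq h1r.le]
      ring
    have hq : y / x = ((1 - r)⁻¹ * y) / (r * x / (1 - r)) * r := by field_simp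
    have hre : Real.exp (-(ν * Real.log r / 2)) = r ^ (-(ν / 2)) := by
      rw [Real.rpow_def_of_pos hr0]; ring_nf
    rw [hsq, hq, hre]
    set A := r * x / (1 - r)
    set B := (1 - r)⁻¹ * y
    rw [Real.mul_rpow (by positivity) hr0.le, mul_assoc (_ ^ _), ← Real.rpow_add hr0,
      add_neg_cancel, Real.rpow_zero, mul_one, Real.sqrt_eq_rpow, ← Real.rpow_mul (by positivity),
      Real.mul_rpow hA.le hB.le, Real.div_rpow hB.le hA.le, ← Real.rpow_natCast,
      div_mul_eq_mul_div, mul_comm (A ^ _) (B ^ _), ← mul_assoc, ← Real.rpow_add hB, mul_div_assoc,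
      ← Real.rpow_sub hA, mul_comm]
    ring_nf
  rw [gammaPDFReal_eq_mul (inv_pos.2 h1r) hy, poissonWeight, add_sub_cancel_right]
  have hexp : Real.exp (-((r * x + y) / (1 - r)) - ν * Real.log r / 2) =
      Real.exp (-(r * x / (1 - r))) * Real.exp (-((1 - r)⁻¹ * y)) *
        Real.exp (-(ν * Real.log r / 2)) := by
    rw [← Real.exp_add, ← Real.exp_add]; ring_nf
  rw [hexp]
  linear_combination (-(Real.exp (-(r * x / (1 - r))) * Real.exp (-((1 - r)⁻¹ * y)) /
    ((m.factorial : ℝ) * Real.Gamma ((m : ℝ) + ν + 1)) / (1 - r))) * hpow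

/-- The Laguerre heat kernel is a Poisson mixture of gamma densities in `y`. -/
theorem hasSum_laguerreHeatFactor {ν r x y : ℝ} (hν : -1 < ν) (hr0 : 0 < r) (hr1 : r < 1)
    (hx : 0 < x) (hy : 0 < y) :
    HasSum (fun m : ℕ => poissonWeight (r * x / (1 - r)) m *
      gammaPDFReal (m + ν + 1) (1 - r)⁻¹ y) (laguerreHeatFactor ν r x y) := by
  have h1r : 0 < 1 - r := by linarith
  have ha : 0 ≤ r * x / (1 - r) := by positivity
  have hsum : Summable (fun m : ℕ => poissonWeight (r * x / (1 - r)) m *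
      gammaPDFReal (m + ν + 1) (1 - r)⁻¹ y) := by
    refine Summable.of_nonneg_of_le (fun m => mul_nonneg (poissonWeight_nonneg ha m)
      (gammaPDFReal_nonneg ?_ (inv_pos.2 h1r) y)) (fun m => ?_)
      ((hasSum_poissonWeight (r * x / (1 - r))).summable.mul_right
        ((1 - r)⁻¹ * (1 + y ^ ν / Real.Gamma (ν + 1))))
    · have : (0 : ℝ) ≤ m := m.cast_nonneg
      linarith
    · exact mul_le_mul_of_nonneg_left (gammaPDFReal_nat_add_le hν
        ((one_le_inv₀ h1r).2 (by linarith)) hy m) (poissonWeight_nonneg ha m)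
  convert! hsum.hasSum using 1
  simp_rw [poissonWeight_mul_gammaPDFReal_eq hr0 hr1 hx hy]
  rw [tsum_div_const, tsum_mul_left]
  rfl

theorem laguerreHeatFactor_nonneg {ν r x y : ℝ} (hν : -1 < ν) (hr0 : 0 < r) (hr1 : r < 1)
    (hx : 0 < x) (hy : 0 < y) : 0 ≤ laguerreHeatFactor ν r x y := by
  have h1r : 0 < 1 - r := by linarith
  refine (hasSum_laguerreHeatFactor hν hr0 hr1 hx hy).nonneg fun m =>
    mul_nonneg (poissonWeight_nonneg (by positivity) m) (gammaPDFReal_nonneg ?_ (inv_pos.2 h1r) y)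
  have : (0 : ℝ) ≤ m := m.cast_nonneg
  linarith

/-- The right-hand side does not depend on `x`, and blows up only like `(1 - r)⁻¹` as `r → 1`. -/
theorem laguerreHeatFactor_le {ν r x y : ℝ} (hν : -1 < ν) (hr0 : 0 < r) (hr1 : r < 1)
    (hx : 0 < x) (hy : 0 < y) :
    laguerreHeatFactor ν r x y ≤ (1 - r)⁻¹ * (1 + y ^ ν / Real.Gamma (ν + 1)) := by
  have h1r : 0 < 1 - r := by linarith
  have h := (hasSum_poissonWeight (r * x / (1 - r))).mul_right
    ((1 - r)⁻¹ * (1 + y ^ ν / Real.Gamma (ν + 1)))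
  rw [one_mul] at h
  exact hasSum_le (fun m => mul_le_mul_of_nonneg_left (gammaPDFReal_nat_add_le hν
        ((one_le_inv₀ h1r).2 (by linarith)) hy m) (poissonWeight_nonneg (by positivity) m))
    (hasSum_laguerreHeatFactor hν hr0 hr1 hx hy) h

/-- The Laguerre heat kernel is a probability density in its second variable. -/
theorem integral_laguerreHeatFactor {ν r x : ℝ} (hν : -1 < ν) (hr0 : 0 < r) (hr1 : r < 1)
    (hx : 0 < x) : ∫ y in Ioi 0, laguerreHeatFactor ν r x y = 1 := by
  have h1r : 0 < 1 - r := by linarith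
  have ha : 0 ≤ r * x / (1 - r) := by positivity
  have hs (m : ℕ) : 0 < (m : ℝ) + ν + 1 := by
    have : (0 : ℝ) ≤ m := m.cast_nonneg
    linarith
  have hF (m : ℕ) : ∫ y in Ioi 0, poissonWeight (r * x / (1 - r)) m *
      gammaPDFReal (m + ν + 1) (1 - r)⁻¹ y = poissonWeight (r * x / (1 - r)) m := by
    rw [integral_const_mul, setIntegral_gammaPDFReal (hs m) (inv_pos.2 h1r), mul_one]
  have key := hasSum_integral_of_summable_integral_norm (μ := volume.restrict (Ioi (0 : ℝ)))
    (F := fun (m : ℕ) y => poissonWeight (r * x / (1 - r)) m *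
      gammaPDFReal (m + ν + 1) (1 - r)⁻¹ y)
    (fun m => ((integrable_gammaPDFReal (hs m) (inv_pos.2 h1r)).const_mul _).integrableOn) (by
      convert! (hasSum_poissonWeight (r * x / (1 - r))).summable using 2 with m
      refine Eq.trans (integral_congr_ae (.of_forall fun y => ?_)) (hF m)
      exact Real.norm_of_nonneg (mul_nonneg (poissonWeight_nonneg ha m)
        (gammaPDFReal_nonneg (hs m) (inv_pos.2 h1r) y)))
  simp_rw [hF] at key
  rw [(hasSum_poissonWeight _).unique key]
  exact setIntegral_congr_fun measurableSet_Ioi fun y hy =>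
    (hasSum_laguerreHeatFactor hν hr0 hr1 hx hy).tsum_eq.symm

theorem measurable_besselI (ν : ℝ) : Measurable (besselI ν) := by
  unfold besselI
  refine Measurable.tsum fun m => ?_
  fun_prop

theorem measurable_laguerreHeatFactor (ν x : ℝ) :
    Measurable fun p : ℝ × ℝ => laguerreHeatFactor ν p.1 x p.2 := by
  have := measurable_besselI ν
  unfold laguerreHeatFactor
  fun_prop

end

/-! ### Laplace transforms of polynomially bounded weights -/

/-- The moment `∫₀^∞ v^(n - 1/2) e^(-s v) K(v) dv` of a weight `K` on the half-line. -/
noncomputable def laplaceMoment (K : ℝ → ℝ) (n : ℕ) (s : ℝ) : ℝ :=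
  ∫ v in Ioi 0, v ^ ((n : ℝ) - 1 / 2) * Real.exp (-(s * v)) * K v

theorem integrableOn_rpow_mul_exp_neg {p s : ℝ} (hp : -1 < p) (hs : 0 < s) :
    IntegrableOn (fun v : ℝ => v ^ p * Real.exp (-(s * v))) (Ioi 0) := by
  simpa using integrableOn_rpow_mul_exp_neg_mul_rpow hp one_pos hs

/-- A measurable weight on the half-line `v > 0` of at most polynomial growth; all its Laplace
moments converge for `s > 0`. -/
structure PolynomiallyBounded (K : ℝ → ℝ) : Prop where
  aestronglyMeasurable : AEStronglyMeasurable K (volume.restrict (Ioi 0))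
  exists_bound : ∃ (C : ℝ) (N : ℕ), ∀ v, 0 < v → |K v| ≤ C * (1 + v) ^ N

namespace PolynomiallyBounded

variable {K : ℝ → ℝ}

theorem integrableOn (hK : PolynomiallyBounded K) (n : ℕ) {s : ℝ} (hs : 0 < s) :
    IntegrableOn (fun v => v ^ ((n : ℝ) - 1 / 2) * Real.exp (-(s * v)) * K v) (Ioi 0) := by
  obtain ⟨C, N, hC⟩ := hK.exists_bound
  have hn : (0 : ℝ) ≤ n := n.cast_nonneg
  have hdom : IntegrableOn (fun v : ℝ => ∑ i ∈ Finset.range (N + 1), C * (N.choose i : ℝ) *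
      (v ^ ((n : ℝ) - 1 / 2 + i) * Real.exp (-(s * v)))) (Ioi 0) := by
    refine integrable_finsetSum _ fun i _ => ?_
    refine (integrableOn_rpow_mul_exp_neg ?_ hs).const_mul _
    have : (0 : ℝ) ≤ i := i.cast_nonneg
    linarith
  refine Integrable.mono' hdom ?_ ?_
  · exact AEStronglyMeasurable.mul (by fun_prop) hK.aestronglyMeasurable
  · filter_upwards [self_mem_ae_restrict measurableSet_Ioi] with v hv
    have hv : 0 < v := hv
    have hpos : 0 < v ^ ((n : ℝ) - 1 / 2) * Real.exp (-(s * v)) := by positivity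
    rw [norm_mul, Real.norm_of_nonneg hpos.le, Real.norm_eq_abs]
    refine (mul_le_mul_of_nonneg_left (hC v hv) hpos.le).trans_eq ?_
    rw [add_comm 1 v, add_pow, Finset.mul_sum, Finset.mul_sum]
    refine Finset.sum_congr rfl fun i _ => ?_
    rw [Real.rpow_add hv, Real.rpow_natCast, one_pow]
    ring

theorem hasDerivAt_laplaceMoment (hK : PolynomiallyBounded K) (n : ℕ) {s : ℝ} (hs : 0 < s) :
    HasDerivAt (laplaceMoment K n) (-laplaceMoment K (n + 1) s) s := by
  have hmeas (m : ℕ) (u : ℝ) : AEStronglyMeasurable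
      (fun v => v ^ ((m : ℝ) - 1 / 2) * Real.exp (-(u * v)) * K v) (volume.restrict (Ioi 0)) :=
    AEStronglyMeasurable.mul (by fun_prop) hK.aestronglyMeasurable
  have h := (hasDerivAt_integral_of_dominated_loc_of_deriv_le (μ := volume.restrict (Ioi (0 : ℝ)))
    (F := fun u v => v ^ ((n : ℝ) - 1 / 2) * Real.exp (-(u * v)) * K v)
    (F' := fun u v => -(v ^ (((n + 1 : ℕ) : ℝ) - 1 / 2) * Real.exp (-(u * v)) * K v))
    (bound := fun v => ‖v ^ (((n + 1 : ℕ) : ℝ) - 1 / 2) * Real.exp (-(s / 2 * v)) * K v‖)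
    (Ioi_mem_nhds (half_lt_self hs)) (.of_forall fun u => hmeas n u) (hK.integrableOn n hs)
    (hmeas (n + 1) s).neg ?_ (hK.integrableOn (n + 1) (half_pos hs)).norm ?_).2
  · rwa [integral_neg] at h
  · filter_upwards [self_mem_ae_restrict measurableSet_Ioi] with v hv u hu
    have hv : 0 < v := hv
    have hu : s / 2 < u := hu
    simp only [norm_neg, norm_mul]
    gcongr
    simpa using by gcongr
  · filter_upwards [self_mem_ae_restrict measurableSet_Ioi] with v hv u hu
    have hv : 0 < v := hv
    have hd : HasDerivAt (fun u : ℝ => Real.exp (-(u * v))) (Real.exp (-(u * v)) * -(1 * v)) u :=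
      ((hasDerivAt_id u).mul_const v).neg.exp
    convert! (hd.const_mul (v ^ ((n : ℝ) - 1 / 2))).mul_const (K v) using 1
    have : v ^ (((n + 1 : ℕ) : ℝ) - 1 / 2) = v ^ ((n : ℝ) - 1 / 2) * v := by
      rw [← Real.rpow_add_one hv.ne']
      push_cast
      ring_nf
    rw [this]
    ring

theorem contDiffOn_laplaceMoment (hK : PolynomiallyBounded K) (k n : ℕ) :
    ContDiffOn ℝ k (laplaceMoment K n) (Ioi 0) := by
  induction k generalizing n with
  | zero =>
    exact contDiffOn_zero.2 fun s hs =>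
      (hK.hasDerivAt_laplaceMoment n hs).continuousAt.continuousWithinAt
  | succ k ih =>
    rw [Nat.cast_add, Nat.cast_one, contDiffOn_succ_iff_deriv_of_isOpen isOpen_Ioi]
    refine ⟨fun s hs => (hK.hasDerivAt_laplaceMoment n hs).differentiableAt.differentiableWithinAt,
      by simp, (ih (n + 1)).neg.congr fun s hs => (hK.hasDerivAt_laplaceMoment n hs).deriv⟩

end PolynomiallyBounded

/-! ### Time derivatives of the subordination integral -/

/-- The integral `t / (2√π) ∫₀^∞ v^(-1/2) e^(-t² v / 4) K(v) dv`; for `K` the values of a semigroup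
at time `1 / v`, this is Bochner's subordination formula for its Poisson semigroup. -/
noncomputable def subordination (K : ℝ → ℝ) (t : ℝ) : ℝ :=
  1 / (2 * √Real.pi) * (t * laplaceMoment K 0 (t ^ 2 / 4))

/-- The coefficient of `t ^ (2 n + 1 - k) * laplaceMoment K n (t² / 4)` in the `k`-th derivative
of `t * laplaceMoment K 0 (t² / 4)`; it vanishes for `n > k`. The exponent may be negative, so
these powers are integer powers. -/
noncomputable def subordinationCoeff : ℕ → ℕ → ℝ
  | 0, 0 => 1
  | 0, _ + 1 => 0
  | k + 1, 0 => (1 - k) * subordinationCoeff k 0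
  | k + 1, n + 1 =>
    (2 * n + 3 - k) * subordinationCoeff k (n + 1) - subordinationCoeff k n / 2

theorem subordinationCoeff_eq_zero {k n : ℕ} (h : k < n) : subordinationCoeff k n = 0 := by
  induction k generalizing n with
  | zero => obtain ⟨n, rfl⟩ := Nat.exists_eq_succ_of_ne_zero h.ne'; rfl
  | succ k ih =>
    obtain ⟨n, rfl⟩ := Nat.exists_eq_succ_of_ne_zero (Nat.ne_zero_of_lt h)
    rw [subordinationCoeff, ih (by omega), ih (by omega)]
    simp

theorem PolynomiallyBounded.contDiffOn_subordination {K : ℝ → ℝ} (hK : PolynomiallyBounded K) :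
    ContDiffOn ℝ (⊤ : ℕ∞) (subordination K) (Ioi 0) := by
  rw [contDiffOn_infty]
  intro k
  refine contDiffOn_const.mul (contDiffOn_id.mul ?_)
  exact (hK.contDiffOn_laplaceMoment k 0).comp (by fun_prop) fun t ht => by
    have ht : 0 < t := ht
    show 0 < t ^ 2 / 4
    positivity

theorem PolynomiallyBounded.iteratedDeriv_subordination {K : ℝ → ℝ} (hK : PolynomiallyBounded K)
    (k : ℕ) {t : ℝ} (ht : 0 < t) :
    iteratedDeriv k (subordination K) t = 1 / (2 * √Real.pi) *
      ∑ n ∈ Finset.range (k + 1), subordinationCoeff k n *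
        (t ^ (2 * (n : ℤ) + 1 - k) * laplaceMoment K n (t ^ 2 / 4)) := by
  induction k generalizing t with
  | zero => simp [subordination, subordinationCoeff]
  | succ k ih =>
    have heq : iteratedDeriv k (subordination K) =ᶠ[nhds t] fun t => 1 / (2 * √Real.pi) *
      ∑ n ∈ Finset.range (k + 1), subordinationCoeff k n *
        (t ^ (2 * (n : ℤ) + 1 - k) * laplaceMoment K n (t ^ 2 / 4)) :=
      Filter.eventuallyEq_of_mem (Ioi_mem_nhds ht) fun u hu => ih hu
    have hM (n : ℕ) : HasDerivAt (fun u : ℝ => laplaceMoment K n (u ^ 2 / 4))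
        (-(t / 2 * laplaceMoment K (n + 1) (t ^ 2 / 4))) t := by
      have h1 : HasDerivAt (fun u : ℝ => u ^ 2 / 4) (t / 2) t := by
        convert! (hasDerivAt_pow 2 t).div_const 4 using 1
        norm_num
        ring
      convert! (hK.hasDerivAt_laplaceMoment n (by positivity : 0 < t ^ 2 / 4)).comp t h1 using 1
      ring
    have hd := (HasDerivAt.fun_sum (u := Finset.range (k + 1)) fun n _ =>
      (((hasDerivAt_zpow (2 * (n : ℤ) + 1 - k) t (.inl ht.ne')).fun_mul (hM n)).const_mul
        (subordinationCoeff k n))).const_mul (1 / (2 * √Real.pi))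
    rw [iteratedDeriv_succ, heq.deriv_eq, HasDerivAt.deriv hd]
    congr 1
    have hz (n : ℕ) : t ^ (2 * (n : ℤ) + 1 - k) * t =
        t ^ (2 * ((n + 1 : ℕ) : ℤ) + 1 - ((k + 1 : ℕ) : ℤ)) := by
      rw [← zpow_add_one₀ ht.ne']
      congr 1
      push_cast
      ring
    have hz' (n : ℕ) : t ^ (2 * (n : ℤ) + 1 - k - 1) =
        t ^ (2 * (n : ℤ) + 1 - ((k + 1 : ℕ) : ℤ)) := by
      congr 1
      push_cast
      ring
    -- Both terms produced by the product rule have the weight `2 n + 1 - (k + 1)`; the second one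
    -- has its index `n` raised by one.
    set T : ℕ → ℝ := fun n =>
      t ^ (2 * (n : ℤ) + 1 - ((k + 1 : ℕ) : ℤ)) * laplaceMoment K n (t ^ 2 / 4) with hT
    calc _ = ∑ n ∈ Finset.range (k + 1), (2 * n + 1 - k) * subordinationCoeff k n * T n -
          ∑ n ∈ Finset.range (k + 1), subordinationCoeff k n / 2 * T (n + 1) := by
          rw [← Finset.sum_sub_distrib]
          refine Finset.sum_congr rfl fun n _ => ?_
          simp only [hT]
          rw [← hz n, hz' n]
          push_cast
          ring
      _ = ∑ n ∈ Finset.range (k + 2), (2 * n + 1 - k) * subordinationCoeff k n * T n -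
          ∑ n ∈ Finset.range (k + 1), subordinationCoeff k n / 2 * T (n + 1) := by
          rw [Finset.sum_range_succ _ (k + 1), subordinationCoeff_eq_zero (Nat.lt_succ_self k)]
          ring
      _ = ∑ n ∈ Finset.range (k + 2), subordinationCoeff (k + 1) n * T n := by
          rw [Finset.sum_range_succ', Finset.sum_range_succ' _ (k + 1), add_sub_right_comm,
            ← Finset.sum_sub_distrib]
          congr 1
          · refine Finset.sum_congr rfl fun n _ => ?_
            rw [subordinationCoeff]
            push_cast
            ring
          · rw [subordinationCoeff]
            push_cast
            ring

/-- The moments of the constant weight `1`, at `s = t² / 4`; they are homogeneous in `t`. -/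
theorem integral_rpow_sub_half_mul_exp_neg (n : ℕ) {t : ℝ} (ht : 0 < t) :
    ∫ v in Ioi 0, v ^ ((n : ℝ) - 1 / 2) * Real.exp (-(t ^ 2 / 4 * v)) =
      2 ^ (2 * n + 1) * Real.Gamma (n + 1 / 2) / t ^ (2 * n + 1) := by
  have h := Real.integral_rpow_mul_exp_neg_mul_Ioi (a := n + 1 / 2) (r := t ^ 2 / 4)
    (by positivity) (by positivity)
  rw [show (n : ℝ) + 1 / 2 - 1 = n - 1 / 2 by ring] at h
  rw [h, show 1 / (t ^ 2 / 4) = (2 / t) ^ (2 : ℝ) by rw [Real.rpow_two]; field_simp; norm_num,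
    ← Real.rpow_mul (by positivity), show 2 * ((n : ℝ) + 1 / 2) = (2 * n + 1 : ℕ) by push_cast; ring,
    Real.rpow_natCast, div_pow]
  ring

/-! ### Kernels subordinated to a Markovian kernel -/

section Fubini

variable {Y : Type*} [MeasurableSpace Y] {μ : Measure Y} [SFinite μ] {K : Y → ℝ → ℝ}

/-- For a Markovian kernel `K`, integrating out `y` replaces the weight by the constant `1`. -/
theorem integrable_laplaceMoment_and_integral_abs_le (hmeas : Measurable (Function.uncurry K))
    (hnonneg : ∀ᵐ y ∂μ, ∀ v, 0 < v → 0 ≤ K y v) (hone : ∀ v, 0 < v → ∫ y, K y v ∂μ = 1)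
    (n : ℕ) {t : ℝ} (ht : 0 < t) :
    Integrable (fun y => laplaceMoment (K y) n (t ^ 2 / 4)) μ ∧
      ∫ y, |laplaceMoment (K y) n (t ^ 2 / 4)| ∂μ ≤
        2 ^ (2 * n + 1) * Real.Gamma (n + 1 / 2) / t ^ (2 * n + 1) := by
  set g : ℝ → ℝ := fun v => v ^ ((n : ℝ) - 1 / 2) * Real.exp (-(t ^ 2 / 4 * v)) with hg
  have hgm : Measurable g := by fun_prop
  have hg0 {v : ℝ} (hv : 0 < v) : 0 ≤ g v := by positivity
  have hgi : IntegrableOn g (Ioi 0) := by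
    refine integrableOn_rpow_mul_exp_neg ?_ (by positivity)
    have : (0 : ℝ) ≤ n := n.cast_nonneg
    linarith
  have hKi {v : ℝ} (hv : 0 < v) : Integrable (fun y => K y v) μ := by
    -- The integral of a non-integrable function is `0`, not `1`.
    by_contra h
    exact zero_ne_one ((integral_undef h).symm.trans (hone v hv))
  have hnorm {v : ℝ} (hv : 0 < v) : ∫ y, ‖g v * K y v‖ ∂μ = g v := by
    have h : ∫ y, ‖g v * K y v‖ ∂μ = ∫ y, g v * K y v ∂μ := by
      refine integral_congr_ae ?_
      filter_upwards [hnonneg] with y hy using Real.norm_of_nonneg (mul_nonneg (hg0 hv) (hy v hv))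
    rw [h, integral_const_mul, hone v hv, mul_one]
  have hprod : Integrable (fun p : Y × ℝ => g p.2 * K p.1 p.2)
      (μ.prod (volume.restrict (Ioi 0))) := by
    have hm : Measurable (fun p : Y × ℝ => g p.2 * K p.1 p.2) :=
      (hgm.comp measurable_snd).mul hmeas
    refine (integrable_prod_iff' hm.aestronglyMeasurable).2 ⟨?_, ?_⟩
    · filter_upwards [self_mem_ae_restrict measurableSet_Ioi] with v hv
      exact (hKi hv).const_mul _
    · refine hgi.congr ?_
      filter_upwards [self_mem_ae_restrict measurableSet_Ioi] with v hv
      exact (hnorm hv).symm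
  refine ⟨hprod.integral_prod_left, ?_⟩
  calc ∫ y, |laplaceMoment (K y) n (t ^ 2 / 4)| ∂μ
      ≤ ∫ y, (∫ v in Ioi 0, ‖g v * K y v‖) ∂μ :=
        integral_mono hprod.integral_prod_left.abs hprod.integral_norm_prod_left
          fun y => norm_integral_le_integral_norm (fun v => g v * K y v)
    _ = ∫ v in Ioi 0, ∫ y, ‖g v * K y v‖ ∂μ := integral_integral_swap hprod.norm
    _ = ∫ v in Ioi 0, g v := setIntegral_congr_fun measurableSet_Ioi fun v hv => hnorm hv
    _ = _ := integral_rpow_sub_half_mul_exp_neg n ht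

/-- A constant bounding `t ^ k` times the `L¹` norm of the `k`-th time derivative of every kernel
subordinated to a Markovian one. -/
noncomputable def subordinationConst (k : ℕ) : ℝ :=
  1 / (2 * √Real.pi) * ∑ n ∈ Finset.range (k + 1),
    |subordinationCoeff k n| * (2 ^ (2 * n + 1) * Real.Gamma (n + 1 / 2))

theorem subordinationConst_nonneg (k : ℕ) : 0 ≤ subordinationConst k := by
  unfold subordinationConst
  refine mul_nonneg (by positivity) (Finset.sum_nonneg fun n _ => ?_)
  have := Real.Gamma_pos_of_pos (by positivity : 0 < (n : ℝ) + 1 / 2)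
  positivity

/-- Subordination turns the Markov property of `K` into scale-invariant `L¹` bounds for all time
derivatives. -/
theorem integrable_iteratedDeriv_subordination_and_integral_abs_le
    (hmeas : Measurable (Function.uncurry K))
    (hnonneg : ∀ᵐ y ∂μ, ∀ v, 0 < v → 0 ≤ K y v) (hone : ∀ v, 0 < v → ∫ y, K y v ∂μ = 1)
    (hK : ∀ᵐ y ∂μ, PolynomiallyBounded (K y)) (k : ℕ) {t : ℝ} (ht : 0 < t) :
    Integrable (fun y => iteratedDeriv k (subordination (K y)) t) μ ∧
      ∫ y, |iteratedDeriv k (subordination (K y)) t| ∂μ ≤ subordinationConst k / t ^ k := by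
  have hM := integrable_laplaceMoment_and_integral_abs_le hmeas hnonneg hone (ht := ht)
  have hπ : 0 ≤ 1 / (2 * √Real.pi) := by positivity
  have hae : ∀ᵐ y ∂μ, iteratedDeriv k (subordination (K y)) t = 1 / (2 * √Real.pi) *
      ∑ n ∈ Finset.range (k + 1), subordinationCoeff k n *
        (t ^ (2 * (n : ℤ) + 1 - k) * laplaceMoment (K y) n (t ^ 2 / 4)) := by
    filter_upwards [hK] with y hy using hy.iteratedDeriv_subordination k ht
  have hint : Integrable (fun y => iteratedDeriv k (subordination (K y)) t) μ :=
    ((integrable_finsetSum _ fun n _ =>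
      (((hM n).1.const_mul _).const_mul _)).const_mul _).congr (hae.mono fun y hy => hy.symm)
  have hdom (n : ℕ) : Integrable (fun y => |subordinationCoeff k n| *
      (t ^ (2 * (n : ℤ) + 1 - k) * |laplaceMoment (K y) n (t ^ 2 / 4)|)) μ :=
    ((hM n).1.abs.const_mul _).const_mul _
  refine ⟨hint, ?_⟩
  calc ∫ y, |iteratedDeriv k (subordination (K y)) t| ∂μ
      ≤ ∫ y, 1 / (2 * √Real.pi) * ∑ n ∈ Finset.range (k + 1), |subordinationCoeff k n| *
          (t ^ (2 * (n : ℤ) + 1 - k) * |laplaceMoment (K y) n (t ^ 2 / 4)|) ∂μ := by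
        refine integral_mono_ae hint.abs
          ((integrable_finsetSum _ fun n _ => hdom n).const_mul _) ?_
        filter_upwards [hae] with y hy
        rw [hy, abs_mul, abs_of_nonneg hπ]
        gcongr
        refine (Finset.abs_sum_le_sum_abs _ _).trans_eq (Finset.sum_congr rfl fun n _ => ?_)
        rw [abs_mul, abs_mul, abs_of_pos (zpow_pos ht _)]
    _ = 1 / (2 * √Real.pi) * ∑ n ∈ Finset.range (k + 1), |subordinationCoeff k n| *
          (t ^ (2 * (n : ℤ) + 1 - k) * ∫ y, |laplaceMoment (K y) n (t ^ 2 / 4)| ∂μ) := by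
        rw [integral_const_mul, integral_finsetSum _ fun n _ => hdom n]
        simp_rw [integral_const_mul]
    _ ≤ 1 / (2 * √Real.pi) * ∑ n ∈ Finset.range (k + 1), |subordinationCoeff k n| *
          (t ^ (2 * (n : ℤ) + 1 - k) *
            (2 ^ (2 * n + 1) * Real.Gamma (n + 1 / 2) / t ^ (2 * n + 1))) := by
        gcongr with n _
        exact (hM n).2
    _ = subordinationConst k / t ^ k := by
        rw [subordinationConst, mul_div_assoc, Finset.sum_div]
        congr 1
        refine Finset.sum_congr rfl fun n _ => ?_
        rw [zpow_sub₀ ht.ne', zpow_natCast,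
          show (2 * (n : ℤ) + 1) = ((2 * n + 1 : ℕ) : ℤ) by push_cast; ring, zpow_natCast]
        field_simp

end Fubini

/-! ### The Poisson-Laguerre kernel -/

section PoissonLaguerre

variable {d : ℕ} {α : Fin d → ℝ}

/-- The `d`-dimensional Laguerre heat kernel at the heat semigroup time `1 / v`. -/
noncomputable def laguerreHeatKernel (α x y : Fin d → ℝ) (v : ℝ) : ℝ :=
  ∏ j, laguerreHeatFactor (α j) (Real.exp (-v⁻¹)) (x j) (y j)

theorem exp_neg_inv_mem_Ioo {v : ℝ} (hv : 0 < v) : Real.exp (-v⁻¹) ∈ Ioo (0 : ℝ) 1 :=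
  ⟨Real.exp_pos _, by simpa using hv⟩

theorem inv_one_sub_exp_neg_inv_le {v : ℝ} (hv : 0 < v) :
    (1 - Real.exp (-v⁻¹))⁻¹ ≤ 1 + v := by
  have h : Real.exp (-v⁻¹) ≤ v / (1 + v) := by
    rw [Real.exp_neg]
    refine (inv_anti₀ (by positivity) (Real.add_one_le_exp v⁻¹)).trans_eq ?_
    field_simp
  refine inv_le_of_inv_le₀ (by positivity) ?_
  have : (1 + v)⁻¹ = 1 - v / (1 + v) := by
    field_simp
    ring
  linarith

theorem image_exp_neg_inv_Ioi : (fun v : ℝ => Real.exp (-v⁻¹)) '' Ioi 0 = Ioo 0 1 := by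
  refine Subset.antisymm (image_subset_iff.2 fun v hv => exp_neg_inv_mem_Ioo hv) fun r hr => ?_
  refine ⟨(-Real.log r)⁻¹, inv_pos.2 (neg_pos.2 (Real.log_neg hr.1 hr.2)), ?_⟩
  simp [Real.exp_log hr.1]

/-- The substitution `r = e^(-1/v)` exhibits the Poisson-Laguerre kernel as a Laplace transform in
`t²`, up to the factor `t`. -/
theorem poissonLaguerreKernel_eq_subordination (α : Fin d → ℝ) (x y : Fin d → ℝ) :
    (fun t => poissonLaguerreKernel α t x y) = subordination (laguerreHeatKernel α x y) := by
  funext t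
  have hd : ∀ v ∈ Ioi (0 : ℝ), HasDerivWithinAt (fun v : ℝ => Real.exp (-v⁻¹))
      (Real.exp (-v⁻¹) * -(-(v ^ 2)⁻¹)) (Ioi 0) v := fun v hv =>
    ((hasDerivAt_inv (ne_of_gt hv)).neg.exp).hasDerivWithinAt
  have hinj : InjOn (fun v : ℝ => Real.exp (-v⁻¹)) (Ioi 0) := fun u _ v _ h => by
    simpa using h
  rw [poissonLaguerreKernel, subordination, laplaceMoment, ← integral_const_mul t,
    ← image_exp_neg_inv_Ioi, integral_image_eq_integral_abs_deriv_smul measurableSet_Ioi hd hinj]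
  congr 1
  refine setIntegral_congr_fun measurableSet_Ioi fun v hv => ?_
  have hv : 0 < v := hv
  have hE := Real.exp_pos (-v⁻¹)
  have h1 : 0 < 1 - Real.exp (-v⁻¹) := sub_pos.2 (exp_neg_inv_mem_Ioo hv).2
  have hpow : v ^ (((0 : ℕ) : ℝ) - 1 / 2) = v ^ (3 / 2 : ℝ) / v ^ 2 := by
    rw [← Real.rpow_natCast v 2, ← Real.rpow_sub hv]
    norm_num
  have hexp : t ^ 2 / (4 * -v⁻¹) = -(t ^ 2 / 4 * v) := by
    field_simp
  have habs : |Real.exp (-v⁻¹) * -(-(v ^ 2)⁻¹)| = Real.exp (-v⁻¹) / v ^ 2 := by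
    rw [neg_neg, abs_of_pos (by positivity), div_eq_mul_inv]
  have hv32 : 0 < v ^ (3 / 2 : ℝ) := by positivity
  simp only [laguerreHeatKernel, laguerreHeatFactor, smul_eq_mul, habs]
  rw [Finset.prod_div_distrib, Finset.prod_const, Finset.card_univ, Fintype.card_fin]
  simp only [Real.log_exp, neg_neg]
  rw [hexp, hpow, Real.inv_rpow hv.le]
  field_simp

theorem laguerreHeatKernel_nonneg (hα : ∀ j, -1 < α j) {x y : Fin d → ℝ} (hx : x ∈ posOrthant d)
    (hy : y ∈ posOrthant d) {v : ℝ} (hv : 0 < v) : 0 ≤ laguerreHeatKernel α x y v :=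
  Finset.prod_nonneg fun j _ => laguerreHeatFactor_nonneg (hα j) (exp_neg_inv_mem_Ioo hv).1
    (exp_neg_inv_mem_Ioo hv).2 (hx j) (hy j)

theorem measurable_laguerreHeatKernel (α x : Fin d → ℝ) :
    Measurable (Function.uncurry (laguerreHeatKernel α x)) := by
  unfold laguerreHeatKernel Function.uncurry
  refine Finset.measurable_fun_prod _ fun j _ => ?_
  exact (measurable_laguerreHeatFactor (α j) (x j)).comp
    (f := fun p : (Fin d → ℝ) × ℝ => (Real.exp (-p.2⁻¹), p.1 j)) (by fun_prop)

theorem posOrthant_eq_pi (d : ℕ) : posOrthant d = univ.pi fun _ => Ioi 0 := by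
  ext y
  simp [posOrthant]

theorem measurableSet_posOrthant (d : ℕ) : MeasurableSet (posOrthant d) := by
  rw [posOrthant_eq_pi]
  exact .univ_pi fun _ => measurableSet_Ioi

theorem integral_laguerreHeatKernel (hα : ∀ j, -1 < α j) {x : Fin d → ℝ} (hx : x ∈ posOrthant d)
    {v : ℝ} (hv : 0 < v) : ∫ y in posOrthant d, laguerreHeatKernel α x y v = 1 := by
  have hr := exp_neg_inv_mem_Ioo hv
  rw [posOrthant_eq_pi, volume_pi, Measure.restrict_pi_pi]
  simp only [laguerreHeatKernel]
  rw [integral_fintype_prod_eq_prod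
    (f := fun j y => laguerreHeatFactor (α j) (Real.exp (-v⁻¹)) (x j) y)]
  exact Finset.prod_eq_one fun j _ => integral_laguerreHeatFactor (hα j) hr.1 hr.2 (hx j)

theorem polynomiallyBounded_laguerreHeatKernel (hα : ∀ j, -1 < α j) {x y : Fin d → ℝ}
    (hx : x ∈ posOrthant d) (hy : y ∈ posOrthant d) :
    PolynomiallyBounded (laguerreHeatKernel α x y) where
  aestronglyMeasurable := ((measurable_laguerreHeatKernel α x).comp
    (measurable_const.prodMk measurable_id : Measurable fun v : ℝ => (y, v))).aestronglyMeasurable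
  exists_bound := by
    refine ⟨∏ j, (1 + y j ^ α j / Real.Gamma (α j + 1)), d, fun v hv => ?_⟩
    have hr := exp_neg_inv_mem_Ioo hv
    rw [abs_of_nonneg (laguerreHeatKernel_nonneg hα hx hy hv)]
    have hc : (∏ j, (1 + y j ^ α j / Real.Gamma (α j + 1))) * (1 + v) ^ d =
        ∏ j, (1 + v) * (1 + y j ^ α j / Real.Gamma (α j + 1)) := by
      simp [Finset.prod_mul_distrib, mul_comm]
    rw [hc]
    refine Finset.prod_le_prod (fun j _ => laguerreHeatFactor_nonneg (hα j) hr.1 hr.2 (hx j) (hy j))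
      fun j _ => (laguerreHeatFactor_le (hα j) hr.1 hr.2 (hx j) (hy j)).trans ?_
    refine mul_le_mul_of_nonneg_right (inv_one_sub_exp_neg_inv_le hv) ?_
    have := Real.Gamma_pos_of_pos (by linarith [hα j] : 0 < α j + 1)
    have := Real.rpow_pos_of_pos (hy j) (α j)
    positivity

/-- The `L¹` bound for all orders `k`, all `α ∈ (-1, ∞)^d` and all subsets of the orthant, with a
constant that depends on `k` only. -/
theorem integrableOn_iteratedDeriv_poissonLaguerreKernel_and_integral_abs_le
    (hα : ∀ j, -1 < α j) (k : ℕ) :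
    ∃ C : ℝ, 0 < C ∧ ∀ t : ℝ, 0 < t → ∀ x ∈ posOrthant d, ∀ S ⊆ posOrthant d,
      IntegrableOn (fun y => iteratedDeriv k (fun s : ℝ => poissonLaguerreKernel α s x y) t) S ∧
      ∫ y in S, |iteratedDeriv k (fun s : ℝ => poissonLaguerreKernel α s x y) t| ≤ C / t ^ k := by
  refine ⟨subordinationConst k + 1, by linarith [subordinationConst_nonneg k],
    fun t ht x hx S hS => ?_⟩
  have hae {p : (Fin d → ℝ) → Prop} (h : ∀ y ∈ posOrthant d, p y) :
      ∀ᵐ y ∂volume.restrict (posOrthant d), p y :=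
    (ae_restrict_iff' (measurableSet_posOrthant d)).2 (.of_forall h)
  obtain ⟨hint, hle⟩ := integrable_iteratedDeriv_subordination_and_integral_abs_le
    (μ := volume.restrict (posOrthant d)) (measurable_laguerreHeatKernel α x)
    (hae fun y hy v hv => laguerreHeatKernel_nonneg hα hx hy hv)
    (fun v hv => integral_laguerreHeatKernel hα hx hv)
    (hae fun y hy => polynomiallyBounded_laguerreHeatKernel hα hx hy) k ht
  simp_rw [poissonLaguerreKernel_eq_subordination]
  refine ⟨IntegrableOn.mono_set hint hS, ?_⟩
  calc ∫ y in S, |iteratedDeriv k (subordination (laguerreHeatKernel α x y)) t|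
      ≤ ∫ y in posOrthant d, |iteratedDeriv k (subordination (laguerreHeatKernel α x y)) t| :=
        setIntegral_mono_set hint.abs (.of_forall fun y => abs_nonneg _) hS.eventuallyLE
    _ ≤ subordinationConst k / t ^ k := hle
    _ ≤ _ := by
        gcongr
        linarith

end PoissonLaguerre

theorem lemma2p1 {d : ℕ} (α : Fin d → ℝ) (hα : ∀ j, -1 < α j) :
    -- the kernel is smooth in time, so that the derivatives below are genuine
    (∀ x ∈ posOrthant d, ∀ y ∈ posOrthant d,
      ContDiffOn ℝ (⊤ : ℕ∞) (fun t : ℝ => poissonLaguerreKernel α t x y) (Ioi 0)) ∧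
    -- the estimate over all of the orthant
    (∃ C : ℝ, 0 < C ∧ ∀ t : ℝ, 0 < t → ∀ x ∈ posOrthant d,
      IntegrableOn (fun y => deriv (fun s : ℝ => poissonLaguerreKernel α s x y) t)
        (posOrthant d) ∧
      ∫ y in posOrthant d, |deriv (fun s : ℝ => poissonLaguerreKernel α s x y) t| ≤ C / t) ∧
    -- (i) all coordinates in the small regime
    (∃ C : ℝ, 0 < C ∧ ∀ t : ℝ, 0 < t → ∀ x ∈ posOrthant d,
      IntegrableOn (fun y => deriv (fun s : ℝ => poissonLaguerreKernel α s x y) t)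
        {y ∈ posOrthant d | ∀ j, regimeArg t x y j ≤ 1} ∧
      ∫ y in {y ∈ posOrthant d | ∀ j, regimeArg t x y j ≤ 1},
        |deriv (fun s : ℝ => poissonLaguerreKernel α s x y) t| ≤ C / t) ∧
    -- (ii) all coordinates in the large regime
    ((∀ j, -(1 / 2) < α j) →
      ∃ C : ℝ, 0 < C ∧ ∀ t : ℝ, 0 < t → ∀ x ∈ posOrthant d,
        IntegrableOn (fun y => deriv (fun s : ℝ => poissonLaguerreKernel α s x y) t)
          {y ∈ posOrthant d | ∀ j, 1 < regimeArg t x y j} ∧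
        ∫ y in {y ∈ posOrthant d | ∀ j, 1 < regimeArg t x y j},
          |deriv (fun s : ℝ => poissonLaguerreKernel α s x y) t| ≤ C / t) ∧
    -- (iii) the coordinates in `J` in the small regime, the others in the large one
    (∀ J : Finset (Fin d), (∀ j, j ∉ J → -(1 / 2) < α j) →
      ∃ C : ℝ, 0 < C ∧ ∀ t : ℝ, 0 < t → ∀ x ∈ posOrthant d,
        IntegrableOn (fun y => deriv (fun s : ℝ => poissonLaguerreKernel α s x y) t)
          {y ∈ posOrthant d | (∀ j ∈ J, regimeArg t x y j ≤ 1) ∧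
            ∀ j, j ∉ J → 1 < regimeArg t x y j} ∧
        ∫ y in {y ∈ posOrthant d | (∀ j ∈ J, regimeArg t x y j ≤ 1) ∧
            ∀ j, j ∉ J → 1 < regimeArg t x y j},
          |deriv (fun s : ℝ => poissonLaguerreKernel α s x y) t| ≤ C / t) ∧
    -- time derivatives of every order `k ≥ 1`
    ((∀ j, -(1 / 2) < α j) → ∀ k : ℕ, 1 ≤ k →
      ∃ C : ℝ, 0 < C ∧ ∀ t : ℝ, 0 < t → ∀ x ∈ posOrthant d,
        IntegrableOn (fun y => iteratedDeriv k (fun s : ℝ => poissonLaguerreKernel α s x y) t)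
          (posOrthant d) ∧
        ∫ y in posOrthant d,
          |iteratedDeriv k (fun s : ℝ => poissonLaguerreKernel α s x y) t| ≤ C / t ^ k) := by
  obtain ⟨C, hC, h⟩ := integrableOn_iteratedDeriv_poissonLaguerreKernel_and_integral_abs_le hα 1
  simp only [iteratedDeriv_one, pow_one] at h
  refine ⟨fun x hx y hy => ?_, ⟨C, hC, fun t ht x hx => h t ht x hx _ Subset.rfl⟩,
    ⟨C, hC, fun t ht x hx => h t ht x hx _ fun y hy => hy.1⟩,
    fun _ => ⟨C, hC, fun t ht x hx => h t ht x hx _ fun y hy => hy.1⟩,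
    fun J _ => ⟨C, hC, fun t ht x hx => h t ht x hx _ fun y hy => hy.1⟩, fun _ k _ => ?_⟩
  · rw [poissonLaguerreKernel_eq_subordination]
    exact (polynomiallyBounded_laguerreHeatKernel hα hx hy).contDiffOn_subordination
  · obtain ⟨C, hC, h⟩ := integrableOn_iteratedDeriv_poissonLaguerreKernel_and_integral_abs_le hα k
    exact ⟨C, hC, fun t ht x hx => h t ht x hx _ Subset.rfl⟩
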